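/- Let $G$ be a finite, simple, undirected graph. For distinct vertices $v,w$ let $\kappa(v,w)$ be the maximum number of pairwise independent (i.e. internally vertex-disjoint) $v$–$w$ paths in $G$, and put $\kappa(v,v)=\infty$. A set $W\subseteq V(G)$ is resolving for $G$ if any two distinct vertices $v_1,v_2\in V(G)$ satisfy $\kappa(v_1,w)\neq\kappa(v_2,w)$ for some $w\in W$. The connectivity dimension $\mathrm{cdim}(G)$ is the minimum cardinality of a resolving set for $G$. A block of $G$ is a maximal connected subgraph $B$ of $G$ that does not contain a cut vertex of $B$, and $b(G)$ denotes the number of blocks of $G$. Theorem. For every connected graph $G$ on at least two vertices, $$\mathrm{cdim}(G)\;\geq\;\frac{b(G)+1}{2}.$$ -/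

import Mathlib

namespace SimpleGraph

/-- Two paths with the same ends are independent (internally vertex disjoint) if they share no
vertex other than their ends. -/
def Path.Independent {V : Type*} {G : SimpleGraph V} {v w : V} (p q : G.Path v w) : Prop :=
  ∀ x, x ∈ p.1.support → x ∈ q.1.support → x = v ∨ x = w

open Classical in
/-- The local connectivity `κ(v, w)`: the maximum number of pairwise independent (distinct) paths
from `v` to `w` in `G`, with the convention `κ(v, v) = ∞`. -/
noncomputable def localConnectivity {V : Type*} (G : SimpleGraph V) (v w : V) : ℕ∞ :=
  if v = w then ⊤
  else ⨆ (S : Set (G.Path v w)) (_ : S.Pairwise Path.Independent), S.encard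

/-- The connectivity representation of `v` with respect to `W`, as a vector indexed by `W`. -/
noncomputable def connectivityRepresentation {V : Type*} (G : SimpleGraph V) (v : V)
    (W : Finset V) : W → ℕ∞ :=
  fun w => G.localConnectivity v w

/-- `W` is resolving for `G` if distinct vertices have distinct representations. -/
def IsConnectivityResolving {V : Type*} (G : SimpleGraph V) (W : Finset V) : Prop :=
  ∀ v₁ v₂ : V,
    G.connectivityRepresentation v₁ W = G.connectivityRepresentation v₂ W → v₁ = v₂

/-- The connectivity dimension: the minimum cardinality of a resolving set. -/
noncomputable def cdim {V : Type*} (G : SimpleGraph V) : ℕ :=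
  sInf {k : ℕ | ∃ W : Finset V, G.IsConnectivityResolving W ∧ W.card = k}

/-- A cut vertex of `G`: it separates two other vertices of the same component of `G`. -/
def IsCutVertex {V : Type*} (G : SimpleGraph V) (v : V) : Prop :=
  ∃ x y : V, x ≠ v ∧ y ≠ v ∧ G.Reachable x y ∧ ∀ p : G.Walk x y, v ∈ p.support

/-- A block of `G`: a maximal connected subgraph `B` without a cut vertex of `B` itself. -/
def IsBlock {V : Type*} (G : SimpleGraph V) (B : G.Subgraph) : Prop :=
  Maximal (fun H : G.Subgraph => H.Connected ∧ ∀ v : H.verts, ¬ H.coe.IsCutVertex v) B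

/-- The number of blocks of `G`. -/
noncomputable def numBlocks {V : Type*} (G : SimpleGraph V) : ℕ :=
  {B : G.Subgraph | G.IsBlock B}.ncard

end SimpleGraph

/-! Two distinct independent paths form a cycle, so `κ(v, w) ≠ 1` for `v ≠ w` forces a common block
with at least three vertices, a large block. Hence a vertex in only one large block `S` has value 1
towards everything outside `S`, while within `S` the values `κ(·, w)` repeat for each `w ∈ S`
(`IsBlockSet.exists_localConnectivity_eq`).

Let `W` be resolving. Give weight `g` equal to 2 on `W`, and 1 to other vertices that lie in two
large blocks or have the all-ones representation (at most one vertex outside `W` does). Every large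
block has weight at least 3 (`IsBlockSet.three_le_sum`). With `t v` the number of large blocks
through `v`, and `N`, `R` the numbers of large and two-vertex blocks, this says `3N ≤ ∑ t g`. The
tree structure of blocks gives `∑ t + R + 1 ≤ |V| + N` (`sum_card_isBlockSet_sub_one_lt`). A
pointwise bound on `t g` combines the two into `N + R + 1 ≤ 2|W|`. -/

namespace SimpleGraph

/-! ### Nonseparable vertex sets and blocks. -/

variable {V : Type*} {G : SimpleGraph V}

/-- Any two vertices of `S` are joined by a walk of `G` inside `S`. -/
def WalkConnected (G : SimpleGraph V) (S : Finset V) : Prop :=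
  ∀ x ∈ S, ∀ y ∈ S, ∃ p : G.Walk x y, ∀ z ∈ p.support, z ∈ S

theorem WalkConnected.of_hub {S T : Finset V} (hS : G.WalkConnected S) (hST : S ⊆ T)
    (h : ∀ z ∈ T, ∃ s ∈ S, ∃ p : G.Walk z s, ∀ u ∈ p.support, u ∈ T) : G.WalkConnected T := by
  intro x hx y hy
  obtain ⟨a, ha, p, hp⟩ := h x hx
  obtain ⟨b, hb, q, hq⟩ := h y hy
  obtain ⟨r, hr⟩ := hS a ha b hb
  refine ⟨(p.append r).append q.reverse, fun z hz => ?_⟩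
  simp only [Walk.mem_support_append_iff, Walk.support_reverse, List.mem_reverse] at hz
  rcases hz with (hz | hz) | hz
  · exact hp z hz
  · exact hST (hr z hz)
  · exact hq z hz

variable [DecidableEq V]

theorem WalkConnected.union {S T : Finset V} (hS : G.WalkConnected S) (hT : G.WalkConnected T)
    {a : V} (haS : a ∈ S) (haT : a ∈ T) : G.WalkConnected (S ∪ T) := by
  refine hS.of_hub Finset.subset_union_left fun z hz => ?_
  rcases Finset.mem_union.1 hz with hz | hz
  · exact ⟨z, hz, Walk.nil, by simp [hz]⟩
  · obtain ⟨p, hp⟩ := hT z hz a haT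
    exact ⟨a, haS, p, fun u hu => Finset.mem_union_right _ (hp u hu)⟩

/-- `S` spans a connected subgraph of `G` that no single vertex separates. -/
def Nonseparable (G : SimpleGraph V) (S : Finset V) : Prop :=
  G.WalkConnected S ∧ ∀ c, G.WalkConnected (S.erase c)

theorem nonseparable_pair {x y : V} (h : G.Adj x y) : G.Nonseparable {x, y} := by
  refine ⟨?_, fun c => ?_⟩
  · intro a ha b hb
    simp only [Finset.mem_insert, Finset.mem_singleton] at ha hb
    rcases ha with rfl | rfl <;> rcases hb with rfl | rfl
    · exact ⟨Walk.nil, by simp⟩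
    · exact ⟨h.toWalk, by simp⟩
    · exact ⟨h.symm.toWalk, by simp⟩
    · exact ⟨Walk.nil, by simp⟩
  · intro a ha b hb
    by_cases hab : a = b
    · subst hab
      exact ⟨Walk.nil, by simpa using ha⟩
    · have hc : c ≠ x ∧ c ≠ y := by
        simp only [Finset.mem_erase, Finset.mem_insert, Finset.mem_singleton] at ha hb
        grind
      have he : ({x, y} : Finset V).erase c = {x, y} := by
        apply Finset.erase_eq_of_notMem; simp [hc.1, hc.2]
      rw [he] at ha hb ⊢
      simp only [Finset.mem_insert, Finset.mem_singleton] at ha hb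
      rcases ha with rfl | rfl <;> rcases hb with rfl | rfl
      · exact absurd rfl hab
      · exact ⟨h.toWalk, by simp⟩
      · exact ⟨h.symm.toWalk, by simp⟩
      · exact absurd rfl hab

/-- Deleting one vertex leaves `a` or `b` as a common vertex through which the two sets stay
connected. -/
theorem Nonseparable.union {S T : Finset V} (hS : G.Nonseparable S) (hT : G.Nonseparable T)
    {a b : V} (hab : a ≠ b) (haS : a ∈ S) (haT : a ∈ T) (hbS : b ∈ S) (hbT : b ∈ T) :
    G.Nonseparable (S ∪ T) := by
  refine ⟨hS.1.union hT.1 haS haT, fun c => ?_⟩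
  rw [Finset.erase_union_distrib]
  by_cases hc : c = a
  · exact (hS.2 c).union (hT.2 c) (a := b) (by grind) (by grind)
  · exact (hS.2 c).union (hT.2 c) (a := a) (by grind) (by grind)

theorem Walk.IsPath.notMem_takeUntil_or_notMem_dropUntil {x y z c : V} {p : G.Walk x y}
    (hp : p.IsPath) (hz : z ∈ p.support) (hcz : c ≠ z) :
    c ∉ (p.takeUntil z hz).support ∨ c ∉ (p.dropUntil z hz).support := by
  by_contra! h
  have hn := hp.support_nodup
  rw [← p.take_spec hz, Walk.support_append, List.nodup_append] at hn
  have h2 := h.2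
  rw [Walk.mem_support_iff] at h2
  exact hn.2.2 c h.1 c (h2.resolve_left hcz) rfl

/-- Adding an ear to a nonseparable set keeps it nonseparable. -/
theorem Nonseparable.union_path {S : Finset V} (hS : G.Nonseparable S) {x y : V}
    {p : G.Walk x y} (hp : p.IsPath) (hx : x ∈ S) (hy : y ∈ S) :
    G.Nonseparable (S ∪ p.support.toFinset) := by
  refine ⟨hS.1.of_hub Finset.subset_union_left fun z hz => ?_, fun c => ?_⟩
  · rcases Finset.mem_union.1 hz with hz | hz
    · exact ⟨z, hz, Walk.nil, by simp [hz]⟩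
    · rw [List.mem_toFinset] at hz
      refine ⟨y, hy, p.dropUntil z hz, fun u hu => Finset.mem_union_right _ ?_⟩
      exact List.mem_toFinset.2 (p.support_dropUntil_subset_support hz hu)
  · refine (hS.2 c).of_hub (Finset.erase_subset_erase _ Finset.subset_union_left) fun z hz => ?_
    obtain ⟨hzc, hz⟩ := Finset.mem_erase.1 hz
    rcases Finset.mem_union.1 hz with hz | hz
    · exact ⟨z, by simp [hz, hzc], Walk.nil, by simp [hz, hzc]⟩
    · rw [List.mem_toFinset] at hz
      rcases hp.notMem_takeUntil_or_notMem_dropUntil hz (Ne.symm hzc) with h | h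
      · refine ⟨x, ?_, (p.takeUntil z hz).reverse, fun u hu => ?_⟩
        · exact Finset.mem_erase.2 ⟨fun e => h (e ▸ Walk.start_mem_support _), hx⟩
        · rw [Walk.support_reverse, List.mem_reverse] at hu
          refine Finset.mem_erase.2 ⟨fun e => h (e ▸ hu), Finset.mem_union_right _ ?_⟩
          exact List.mem_toFinset.2 (p.support_takeUntil_subset_support hz hu)
      · refine ⟨y, ?_, p.dropUntil z hz, fun u hu => ?_⟩
        · exact Finset.mem_erase.2 ⟨fun e => h (e ▸ Walk.end_mem_support _), hy⟩
        · refine Finset.mem_erase.2 ⟨fun e => h (e ▸ hu), Finset.mem_union_right _ ?_⟩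
          exact List.mem_toFinset.2 (p.support_dropUntil_subset_support hz hu)

/-- The vertex set of a block: a maximal nonseparable set. -/
def IsBlockSet (G : SimpleGraph V) (S : Finset V) : Prop := Maximal G.Nonseparable S

theorem IsBlockSet.mem_of_path {S : Finset V} (hS : G.IsBlockSet S) {x y z : V}
    {p : G.Walk x y} (hp : p.IsPath) (hx : x ∈ S) (hy : y ∈ S)
    (hz : z ∈ p.support) : z ∈ S :=
  hS.2 (hS.1.union_path hp hx hy) Finset.subset_union_left
    (Finset.mem_union_right _ (List.mem_toFinset.2 hz))

theorem IsBlockSet.eq_of_two_common {S T : Finset V} (hS : G.IsBlockSet S) (hT : G.IsBlockSet T)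
    {a b : V} (hab : a ≠ b) (haS : a ∈ S) (haT : a ∈ T) (hbS : b ∈ S) (hbT : b ∈ T) : S = T := by
  have h := hS.1.union hT.1 hab haS haT hbS hbT
  exact (hS.eq_of_le h Finset.subset_union_left).trans
    (hT.eq_of_le h Finset.subset_union_right).symm

theorem exists_isBlockSet_of_adj [Finite V] {x y : V} (h : G.Adj x y) :
    ∃ S, G.IsBlockSet S ∧ x ∈ S ∧ y ∈ S := by
  obtain ⟨S, hle, hS⟩ := (Set.toFinite {S | G.Nonseparable S}).exists_le_maximal
    (nonseparable_pair h)
  exact ⟨S, hS, hle (by simp), hle (by simp)⟩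

/-- The empty set and singletons are nonseparable too, but here each extends to an edge and so is
not maximal. -/
theorem IsBlockSet.two_le_card [Finite V] [Nontrivial V] (hG : G.Connected) {S : Finset V}
    (hS : G.IsBlockSet S) : 2 ≤ S.card := by
  by_contra! hlt
  have key : ∀ x y, G.Adj x y → ¬ S ⊆ {x, y} := by
    intro x y hxy hsub
    have := hS.eq_of_le (nonseparable_pair hxy) hsub
    rw [this, Finset.card_pair hxy.ne] at hlt
    omega
  have h1 : ∃ x, S ⊆ {x} := by
    have := hG.nonempty
    exact Finset.card_le_one_iff_subset_singleton.1 (by omega)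
  obtain ⟨x, hx⟩ := h1
  obtain ⟨y, hy⟩ := hG.preconnected.exists_adj_of_nontrivial x
  exact key x y hy (hx.trans (by simp))

/-- Two distinct independent paths lie in a common block, which has at least three vertices. -/
theorem exists_isBlockSet_of_independent [Finite V] {v w : V} (hvw : v ≠ w) {p q : G.Path v w}
    (hpq : p ≠ q) (hind : p.Independent q) :
    ∃ S, G.IsBlockSet S ∧ v ∈ S ∧ w ∈ S ∧ 3 ≤ S.card := by
  obtain ⟨p, hp⟩ := p
  obtain ⟨q, hq⟩ := q
  have hpq' : p ≠ q := fun h => hpq (Subtype.ext h)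
  cases p with
  | nil => exact absurd rfl hvw
  | cons h p =>
    rename_i a
    obtain ⟨S, hS, hv, ha⟩ := exists_isBlockSet_of_adj h
    rw [Walk.cons_isPath_iff] at hp
    -- The cycle minus its first edge is a path whose ends `a`, `v` lie in `S`, so `S` absorbs the
    -- whole cycle.
    have hpath : (p.append q.reverse).IsPath := by
      rw [Walk.isPath_def, Walk.support_append, List.nodup_append]
      refine ⟨hp.1.support_nodup, (hq.reverse.support_nodup).tail, ?_⟩
      rintro x hx _ hx' rfl
      have hn := hq.reverse.support_nodup
      rw [← Walk.cons_tail_support] at hn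
      have hxw : x ≠ w := fun e => (List.nodup_cons.1 hn).1 (e ▸ hx')
      have hxq : x ∈ q.support := by
        have := List.mem_of_mem_tail hx'
        simpa using this
      have := hind x (by simp [hx]) hxq
      rcases this with rfl | h
      · exact hp.2 hx
      · exact hxw h
    have hsub : ∀ z ∈ (p.append q.reverse).support, z ∈ S :=
      fun z hz => hS.mem_of_path hpath ha hv hz
    have hw : w ∈ S := hsub w (by simp)
    refine ⟨S, hS, hv, hw, ?_⟩
    have three : ∀ z ∈ S, z ≠ v → z ≠ w → 3 ≤ S.card := by
      intro z hz hzv hzw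
      have : ({z, v, w} : Finset V) ⊆ S := by
        intro u; simp only [Finset.mem_insert, Finset.mem_singleton]; grind
      calc 3 = ({z, v, w} : Finset V).card := by
            rw [Finset.card_insert_of_notMem, Finset.card_pair hvw]; simp [hzv, hzw]
        _ ≤ _ := Finset.card_le_card this
    -- If the first path is the edge `vw`, the third vertex has to come from the other path.
    by_cases haw : a = w
    · subst haw
      have hpn : p = Walk.nil := (Walk.isPath_iff_nil.1 hp.1).eq_nil
      subst hpn
      cases q with
      | nil => exact absurd rfl hvw
      | cons h' q =>
        rename_i b
        refine three b (hsub b (by simp)) h'.ne' ?_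
        rintro rfl
        rw [Walk.cons_isPath_iff] at hq
        have hqn : q = Walk.nil := (Walk.isPath_iff_nil.1 hq.1).eq_nil
        subst hqn
        exact hpq' rfl
    · exact three a ha h.ne' haw

end SimpleGraph

/-! ### Bounds on local connectivity. -/

namespace SimpleGraph

variable {V : Type*} {G : SimpleGraph V}

theorem localConnectivity_self (v : V) : G.localConnectivity v v = ⊤ := by
  simp [localConnectivity]

theorem localConnectivity_le_iff {v w : V} (hvw : v ≠ w) {n : ℕ∞} :
    G.localConnectivity v w ≤ n ↔
      ∀ S : Set (G.Path v w), S.Pairwise Path.Independent → S.encard ≤ n := by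
  simp [localConnectivity, hvw]

theorem encard_le_localConnectivity {v w : V} (hvw : v ≠ w) {S : Set (G.Path v w)}
    (hS : S.Pairwise Path.Independent) : S.encard ≤ G.localConnectivity v w :=
  (localConnectivity_le_iff hvw).1 le_rfl S hS

theorem one_le_localConnectivity (hG : G.Connected) (v w : V) :
    1 ≤ G.localConnectivity v w := by
  classical
  by_cases hvw : v = w
  · subst hvw; simp [localConnectivity_self]
  · obtain ⟨p⟩ := hG.preconnected v w
    have := encard_le_localConnectivity hvw (Set.pairwise_singleton p.toPath Path.Independent)
    simpa using this

theorem localConnectivity_symm (v w : V) :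
    G.localConnectivity v w = G.localConnectivity w v := by
  have key : ∀ v w, v ≠ w → G.localConnectivity v w ≤ G.localConnectivity w v := by
    intro v w hvw
    rw [localConnectivity_le_iff hvw]
    intro S hS
    have hinj : Function.Injective (Path.reverse : G.Path v w → G.Path w v) := by
      intro p q h
      have := congrArg (fun r => r.1.reverse) h
      exact Subtype.ext (by simpa using this)
    rw [← hinj.encard_image]
    refine encard_le_localConnectivity hvw.symm ?_
    rintro _ ⟨p, hp, rfl⟩ _ ⟨q, hq, rfl⟩ hne x hx hx'
    have := hS hp hq (fun h => hne (h ▸ rfl)) x (by simpa using hx) (by simpa using hx')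
    exact this.symm
  by_cases hvw : v = w
  · rw [hvw]
  · exact le_antisymm (key v w hvw) (key w v (Ne.symm hvw))

/-- Independent paths have distinct second vertices. -/
theorem localConnectivity_le_encard {v w : V} (hvw : v ≠ w) {N : Set V}
    (hN : ∀ p : G.Path v w, p.1.snd ∈ N) : G.localConnectivity v w ≤ N.encard := by
  rw [localConnectivity_le_iff hvw]
  intro S hS
  refine Set.encard_le_encard_of_injOn (f := fun p => p.1.snd) (fun p _ => hN p) ?_
  intro p hp q hq hpq
  by_contra hne
  have hind := hS hp hq hne
  obtain ⟨p, hp'⟩ := p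
  obtain ⟨q, hq'⟩ := q
  cases p with
  | nil => exact hvw rfl
  | cons h p =>
    cases q with
    | nil => exact hvw rfl
    | cons h' q =>
      simp only [Walk.snd_cons] at hpq
      subst hpq
      rename_i a
      rcases hind a (by simp) (by simp) with e | e
      · exact h.ne' e
      · subst e
        rw [Walk.cons_isPath_iff] at hp' hq'
        have e1 := (Walk.isPath_iff_nil.1 hp'.1).eq_nil
        have e2 := (Walk.isPath_iff_nil.1 hq'.1).eq_nil
        subst e1 e2
        exact hne rfl

theorem localConnectivity_lt_top [Finite V] {v w : V} (hvw : v ≠ w) :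
    G.localConnectivity v w < ⊤ :=
  (localConnectivity_le_encard hvw (N := Set.univ) (by simp)).trans_lt
    (Set.toFinite _).encard_lt_top

theorem two_le_localConnectivity_of_triangle {x y w : V} (hxw : G.Adj x w) (hxy : G.Adj x y)
    (hyw : G.Adj y w) : 2 ≤ G.localConnectivity x w := by
  let p : G.Path x w := ⟨hxw.toWalk, by simp [hxw.ne]⟩
  let q : G.Path x w := ⟨Walk.cons hxy hyw.toWalk, by
    simp [Walk.cons_isPath_iff, hxw.ne, hxy.ne, hyw.ne]⟩
  have hpq : p ≠ q := by
    intro h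
    have := congrArg (fun r => r.1.length) h
    simp [p, q] at this
  rw [← Set.encard_pair hpq]
  refine encard_le_localConnectivity hxw.ne ?_
  rintro r hr s hs hne z hz hz'
  rcases hr with rfl | rfl <;> rcases hs with rfl | rfl
  · exact absurd rfl hne
  · simpa [p] using hz
  · simpa [p] using hz'
  · exact absurd rfl hne

variable [DecidableEq V]

theorem localConnectivity_eq_one [Finite V] (hG : G.Connected) {v w : V} (hvw : v ≠ w)
    (h : ∀ S, G.IsBlockSet S → v ∈ S → w ∈ S → S.card < 3) : G.localConnectivity v w = 1 := by
  refine le_antisymm ((localConnectivity_le_iff hvw).2 fun S hS => ?_)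
    (one_le_localConnectivity hG v w)
  refine Set.encard_le_one_iff.2 fun p q hp hq => ?_
  by_contra hne
  obtain ⟨B, hB, hv, hw, hc⟩ := exists_isBlockSet_of_independent hvw hne (hS hp hq hne)
  exact absurd (h B hB hv hw) (by omega)

/-- Paths between vertices of a block stay inside it, so their second vertices are neighbours of `v`
in `S`. -/
theorem IsBlockSet.localConnectivity_le [DecidableRel G.Adj] {S : Finset V} (hS : G.IsBlockSet S)
    {v w : V} (hvw : v ≠ w) (hv : v ∈ S) (hw : w ∈ S) :
    G.localConnectivity v w ≤ (S.filter (G.Adj v)).card := by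
  rw [← Set.encard_coe_eq_coe_finsetCard]
  refine localConnectivity_le_encard hvw fun p => ?_
  have hn : ¬ p.1.Nil := Walk.not_nil_of_ne hvw
  simp only [Finset.coe_filter, Set.mem_ofPred_eq]
  exact ⟨hS.mem_of_path p.2 hv hw (p.1.getVert_mem_support 1), p.1.adj_snd hn⟩

theorem IsBlockSet.localConnectivity_le_card {S : Finset V} (hS : G.IsBlockSet S)
    {v w : V} (hvw : v ≠ w) (hv : v ∈ S) (hw : w ∈ S) :
    G.localConnectivity v w ≤ (S.card - 1 : ℕ) := by
  classical
  refine (hS.localConnectivity_le hvw hv hw).trans ?_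
  rw [← Finset.card_erase_of_mem hv]
  exact_mod_cast Finset.card_le_card fun u hu => by
    rw [Finset.mem_filter] at hu
    exact Finset.mem_erase.2 ⟨hu.2.ne', hu.1⟩

theorem IsBlockSet.adj_of_card_le {S : Finset V} (hS : G.IsBlockSet S)
    {v w : V} (hvw : v ≠ w) (hv : v ∈ S) (hw : w ∈ S)
    (h : ((S.card - 1 : ℕ) : ℕ∞) ≤ G.localConnectivity v w) {u : V} (hu : u ∈ S) (huv : u ≠ v) :
    G.Adj v u := by
  classical
  have h1 : S.card - 1 ≤ (S.filter (G.Adj v)).card := by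
    exact_mod_cast h.trans (hS.localConnectivity_le hvw hv hw)
  have h2 : S.filter (G.Adj v) ⊆ S.erase v := fun u hu => by
    rw [Finset.mem_filter] at hu
    exact Finset.mem_erase.2 ⟨hu.2.ne', hu.1⟩
  have h3 := Finset.eq_of_subset_of_card_le h2 (by rwa [Finset.card_erase_of_mem hv])
  have : u ∈ S.filter (G.Adj v) := h3 ▸ Finset.mem_erase.2 ⟨huv, hu⟩
  exact (Finset.mem_filter.1 this).2

/-- In a block with at least three vertices, two vertices have the same local connectivity to a
given third one. -/
theorem IsBlockSet.exists_localConnectivity_eq (hG : G.Connected) {S : Finset V}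
    (hS : G.IsBlockSet S) (hc : 3 ≤ S.card) {w : V} (hw : w ∈ S) :
    ∃ x ∈ S, ∃ y ∈ S, x ≠ w ∧ y ≠ w ∧ x ≠ y ∧
      G.localConnectivity x w = G.localConnectivity y w := by
  -- Pigeonhole: `|S| - 1` vertices, at most `|S| - 2` values. A priori the range is `1, …, |S| -
  -- 1`, and one end must be excluded.
  suffices h : ∃ a b : ℕ, b + 1 - a < S.card - 1 ∧
      ∀ x ∈ S.erase w, (a : ℕ∞) ≤ G.localConnectivity x w ∧ G.localConnectivity x w ≤ b by
    obtain ⟨a, b, hab, h⟩ := h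
    have hcard : ((Finset.Icc a b).image ((↑) : ℕ → ℕ∞)).card < (S.erase w).card := by
      rw [Finset.card_erase_of_mem hw]
      exact Finset.card_image_le.trans_lt (by simpa using hab)
    obtain ⟨x, hx, y, hy, hxy, he⟩ :=
      Finset.exists_ne_map_eq_of_card_lt_of_maps_to hcard
        (f := fun x => G.localConnectivity x w) (fun x hx => by
          obtain ⟨h1, h2⟩ := h x hx
          obtain ⟨m, hm, hmb⟩ := ENat.le_natCast_iff.1 h2
          rw [hm] at h1
          simp only [Finset.coe_image, Set.mem_image]
          exact ⟨m, by simpa [hmb] using h1, hm.symm⟩)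
    rw [Finset.mem_erase] at hx hy
    exact ⟨x, hx.2, y, hy.2, hx.1, hy.1, hxy, he⟩
  have hle : ∀ x ∈ S.erase w, G.localConnectivity x w ≤ (S.card - 1 : ℕ) := fun x hx =>
    hS.localConnectivity_le_card (Finset.ne_of_mem_erase hx) (Finset.mem_of_mem_erase hx) hw
  -- If the top value occurs at `y`, then `y` and `w` are adjacent to all of `S`, and triangles
  -- exclude the value 1.
  by_cases hmax : ∃ y ∈ S.erase w, ((S.card - 1 : ℕ) : ℕ∞) ≤ G.localConnectivity y w
  · obtain ⟨y, hy, hyw⟩ := hmax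
    obtain ⟨hne, hyS⟩ := Finset.mem_erase.1 hy
    have ady : ∀ u ∈ S, u ≠ y → G.Adj y u := fun u hu huy =>
      hS.adj_of_card_le hne hyS hw hyw hu huy
    have adw : ∀ u ∈ S, u ≠ w → G.Adj w u := fun u hu huw =>
      hS.adj_of_card_le hne.symm hw hyS (localConnectivity_symm y w ▸ hyw) hu huw
    refine ⟨2, S.card - 1, by omega, fun x hx => ⟨?_, hle x hx⟩⟩
    obtain ⟨hxw, hxS⟩ := Finset.mem_erase.1 hx
    by_cases hxy : x = y
    · subst hxy
      obtain ⟨z, hz⟩ : ((S.erase w).erase x).Nonempty := by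
        rw [← Finset.card_pos, Finset.card_erase_of_mem hx, Finset.card_erase_of_mem hw]
        omega
      simp only [Finset.mem_erase] at hz
      exact two_le_localConnectivity_of_triangle (ady w hw hxw.symm) (ady z hz.2.2 hz.1)
        (adw z hz.2.2 hz.2.1).symm
    · exact two_le_localConnectivity_of_triangle (adw x hxS hxw).symm (ady x hxS hxy).symm
        (ady w hw hne.symm)
  · push Not at hmax
    refine ⟨1, S.card - 2, by omega, fun x hx => ⟨?_, ?_⟩⟩
    · exact_mod_cast one_le_localConnectivity hG x w
    · have h1 := hmax x hx
      obtain ⟨m, hm, hmb⟩ := ENat.le_natCast_iff.1 (hle x hx)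
      rw [hm] at h1 ⊢
      norm_cast at h1 ⊢
      omega

end SimpleGraph

/-! ### Counting vertices along the block tree. -/

namespace SimpleGraph

variable {V : Type*} {G : SimpleGraph V} [DecidableEq V]

/-- `S` has a gate towards `r`: a vertex from which `r` is reachable while avoiding any other
given vertex of `S`. -/
theorem exists_gate (hG : G.Connected) (r : V) {S : Finset V} (hS : S.Nonempty) :
    ∃ a ∈ S, ∀ v ∈ S, v ≠ a → ∃ p : G.Walk a r, v ∉ p.support := by
  -- The gate is a vertex of `S` nearest to `r`; a geodesic to `r` meets no other vertex of `S`.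
  obtain ⟨a, ha, hmin⟩ := S.exists_min_image (fun x => G.dist x r) hS
  refine ⟨a, ha, fun v hv hva => ?_⟩
  obtain ⟨p, hp⟩ := (hG.preconnected a r).exists_walk_length_eq_dist
  refine ⟨p, fun hvp => ?_⟩
  have h1 := hmin v hv
  have h2 := SimpleGraph.dist_le (p.dropUntil v hvp)
  have h3 := congrArg Walk.length (p.take_spec hvp)
  rw [Walk.length_append] at h3
  have h4 : (p.takeUntil v hvp).length ≠ 0 := fun h => hva (Walk.eq_of_length_eq_zero h).symm
  omega

/-- Let `c` follow `v` on a path in `T` to `b`. Continuing from `c` via `b` and `r` to `a` without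
`v` gives a path between vertices of `S`; hence `c ∈ S`, and the blocks share `v` and `c`. -/
theorem IsBlockSet.eq_of_walks_avoiding {S T : Finset V} (hS : G.IsBlockSet S)
    (hT : G.IsBlockSet T) {v a b r : V} (hvS : v ∈ S) (hvT : v ∈ T) (haS : a ∈ S) (hbT : b ∈ T)
    (p : G.Walk a r) (hp : v ∉ p.support) (q : G.Walk b r) (hq : v ∉ q.support) : S = T := by
  have hvb : v ≠ b := fun h => hq (h ▸ Walk.start_mem_support q)
  obtain ⟨s, hs⟩ := hT.1.1 v hvT b hbT
  cases hs' : s.bypass with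
  | nil => exact absurd rfl hvb
  | cons h s' =>
    rename_i c
    have hpath := s.bypass_isPath
    rw [hs', Walk.cons_isPath_iff] at hpath
    have hcT : c ∈ T := hs c (s.support_bypass_subset_support (by rw [hs']; simp))
    let m := (s'.append (q.append p.reverse)).bypass
    have hm : v ∉ m.support := fun hv => by
      have := Walk.support_bypass_subset_support _ hv
      simp only [Walk.mem_support_append_iff, Walk.support_reverse, List.mem_reverse] at this
      tauto
    have hcons : (Walk.cons h m).IsPath :=
      Walk.cons_isPath_iff _ _ |>.2 ⟨Walk.bypass_isPath _, hm⟩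
    have hcS : c ∈ S := hS.mem_of_path hcons hvS haS (by simp)
    exact hS.eq_of_two_common hT h.ne hvS hvT hcS hcT

/-- Blocks with their gates towards a root `r` removed are pairwise disjoint and miss `r`. -/
theorem sum_card_isBlockSet_sub_one_lt [Fintype V] [Nontrivial V] (hG : G.Connected)
    (𝓑 : Finset (Finset V)) (h𝓑 : ∀ S ∈ 𝓑, G.IsBlockSet S) :
    ∑ S ∈ 𝓑, (S.card - 1) + 1 ≤ Fintype.card V := by
  obtain ⟨r⟩ := hG.nonempty
  have hex : ∀ S : 𝓑, ∃ a ∈ S.1, ∀ v ∈ S.1, v ≠ a → ∃ p : G.Walk a r, v ∉ p.support := fun S =>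
    exists_gate hG r (Finset.card_pos.1 (by have := (h𝓑 S.1 S.2).two_le_card hG; omega))
  choose gate hgate havoid using hex
  have hdisj : ((Finset.univ : Finset 𝓑) : Set 𝓑).PairwiseDisjoint fun S => S.1.erase (gate S) := by
    intro S _ T _ hne
    refine Finset.disjoint_left.2 fun v hv hv' => hne (Subtype.ext ?_)
    rw [Finset.mem_erase] at hv hv'
    obtain ⟨p, hp⟩ := havoid S v hv.2 hv.1
    obtain ⟨q, hq⟩ := havoid T v hv'.2 hv'.1
    exact (h𝓑 S.1 S.2).eq_of_walks_avoiding (h𝓑 T.1 T.2) hv.2 hv'.2 (hgate S) (hgate T) p hp q hq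
  have hcard := Finset.card_biUnion hdisj
  have hsub : (Finset.univ : Finset 𝓑).biUnion (fun S => S.1.erase (gate S)) ⊆
      Finset.univ.erase r := by
    intro v hv
    rw [Finset.mem_biUnion] at hv
    obtain ⟨S, -, hv⟩ := hv
    rw [Finset.mem_erase] at hv
    obtain ⟨p, hp⟩ := havoid S v hv.2 hv.1
    exact Finset.mem_erase.2 ⟨fun h => hp (h ▸ Walk.end_mem_support p), Finset.mem_univ v⟩
  have hle := Finset.card_le_card hsub
  rw [hcard, Finset.card_erase_of_mem (Finset.mem_univ r), Finset.card_univ] at hle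
  rw [← Finset.sum_coe_sort]
  have : ∑ S : 𝓑, (S.1.card - 1) = ∑ S : 𝓑, (S.1.erase (gate S)).card :=
    Finset.sum_congr rfl fun S _ => (Finset.card_erase_of_mem (hgate S)).symm
  rw [this]
  have : 0 < Fintype.card V := Fintype.card_pos_iff.2 ⟨r⟩
  omega

end SimpleGraph

/-! ### Resolving sets; blocks as subgraphs and as vertex sets. -/

namespace SimpleGraph

variable {V : Type*} {G : SimpleGraph V}

theorem Walk.exists_coe_induce {S : Set V} {x y : V} (p : G.Walk x y)
    (hp : ∀ z ∈ p.support, z ∈ S) (hx : x ∈ S) (hy : y ∈ S) :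
    ∃ q : ((⊤ : G.Subgraph).induce S).coe.Walk ⟨x, hx⟩ ⟨y, hy⟩,
      ∀ z ∈ q.support, z.1 ∈ p.support := by
  induction p with
  | nil => exact ⟨Walk.nil, by simp⟩
  | cons h p ih =>
    rename_i a b c
    have hb : b ∈ S := hp b (by simp)
    obtain ⟨q, hq⟩ := ih (fun z hz => hp z (by simp [hz])) hb hy
    have hadj : ((⊤ : G.Subgraph).induce S).coe.Adj ⟨a, hx⟩ ⟨b, hb⟩ := ⟨hx, hb, h⟩
    refine ⟨Walk.cons hadj q, fun z hz => ?_⟩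
    rw [Walk.support_cons, List.mem_cons] at hz ⊢
    rcases hz with rfl | hz
    · exact Or.inl rfl
    · exact Or.inr (hq z hz)

theorem Walk.exists_of_subgraph_coe {H : G.Subgraph} {x y : H.verts} (p : H.coe.Walk x y) :
    ∃ q : G.Walk x.1 y.1, ∀ z ∈ q.support, ∃ u ∈ p.support, u.1 = z := by
  refine ⟨p.map H.hom, fun z hz => ?_⟩
  have hz' : z ∈ (p.map H.hom).support := hz
  rw [Walk.support_map] at hz'
  exact List.mem_map.1 hz'

theorem IsConnectivityResolving.exists_ne {W : Finset V} (hW : G.IsConnectivityResolving W)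
    {x y : V} (hxy : x ≠ y) :
    ∃ w ∈ W, G.localConnectivity x w ≠ G.localConnectivity y w := by
  by_contra! h
  exact hxy (hW x y (funext fun w => h w.1 w.2))

/-- The infimum is attained because `univ` resolves: only `κ(x, x)` is infinite. -/
theorem exists_isConnectivityResolving_card_eq_cdim [Fintype V] (G : SimpleGraph V) :
    ∃ W : Finset V, G.IsConnectivityResolving W ∧ W.card = G.cdim := by
  refine Nat.sInf_mem (s := {k | ∃ W : Finset V, G.IsConnectivityResolving W ∧ W.card = k})
    ⟨_, Finset.univ, fun x y h => ?_, rfl⟩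
  by_contra hxy
  have h1 : G.localConnectivity x x = G.localConnectivity y x :=
    congrFun h ⟨x, Finset.mem_univ x⟩
  rw [localConnectivity_self] at h1
  exact (localConnectivity_lt_top (Ne.symm hxy)).ne h1.symm

variable [DecidableEq V]

theorem nonseparable_of_not_isCutVertex {H : G.Subgraph} {S : Finset V} (hS : (S : Set V) = H.verts)
    (hc : H.Connected) (hH : ∀ v : H.verts, ¬ H.coe.IsCutVertex v) : G.Nonseparable S := by
  have hmem : ∀ z, z ∈ S ↔ z ∈ H.verts := fun z => by rw [← hS, Finset.mem_coe]
  have hconn : G.WalkConnected S := by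
    intro x hx y hy
    obtain ⟨p⟩ := hc.preconnected ⟨x, (hmem x).1 hx⟩ ⟨y, (hmem y).1 hy⟩
    obtain ⟨q, hq⟩ := p.exists_of_subgraph_coe
    refine ⟨q, fun z hz => ?_⟩
    obtain ⟨u, -, rfl⟩ := hq z hz
    exact (hmem _).2 u.2
  refine ⟨hconn, fun c => ?_⟩
  by_cases hcS : c ∈ S
  · intro x hx y hy
    rw [Finset.mem_erase] at hx hy
    by_contra hno
    refine hH ⟨c, (hmem c).1 hcS⟩ ⟨⟨x, (hmem x).1 hx.2⟩, ⟨y, (hmem y).1 hy.2⟩, ?_, ?_,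
      hc.preconnected _ _, fun p => ?_⟩
    · exact fun h => hx.1 (congrArg Subtype.val h)
    · exact fun h => hy.1 (congrArg Subtype.val h)
    · by_contra hcp
      obtain ⟨q, hq⟩ := p.exists_of_subgraph_coe
      refine hno ⟨q, fun z hz => ?_⟩
      obtain ⟨u, hu, rfl⟩ := hq z hz
      refine Finset.mem_erase.2 ⟨fun h => hcp ?_, (hmem _).2 u.2⟩
      have : u = ⟨c, (hmem c).1 hcS⟩ := Subtype.ext h
      rwa [this] at hu
  · rwa [Finset.erase_eq_of_notMem hcS]

theorem Nonseparable.induce {S : Finset V} (hS : G.Nonseparable S) (hne : S.Nonempty) :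
    ((⊤ : G.Subgraph).induce (S : Set V)).Connected ∧
      ∀ v : ((⊤ : G.Subgraph).induce (S : Set V)).verts,
        ¬ ((⊤ : G.Subgraph).induce (S : Set V)).coe.IsCutVertex v := by
  constructor
  · rw [Subgraph.connected_iff, Subgraph.preconnected_iff]
    refine ⟨?_, hne⟩
    rintro ⟨x, hx⟩ ⟨y, hy⟩
    obtain ⟨p, hp⟩ := hS.1 x hx y hy
    exact ⟨(p.exists_coe_induce hp hx hy).choose⟩
  · rintro ⟨v, hv⟩ ⟨⟨x, hx⟩, ⟨y, hy⟩, hxv, hyv, -, h⟩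
    obtain ⟨p, hp⟩ := hS.2 v x (Finset.mem_erase.2 ⟨fun e => hxv (Subtype.ext e), hx⟩) y
      (Finset.mem_erase.2 ⟨fun e => hyv (Subtype.ext e), hy⟩)
    obtain ⟨q, hq⟩ := p.exists_coe_induce (fun z hz => Finset.mem_of_mem_erase (hp z hz)) hx hy
    exact Finset.notMem_erase v S (hp v (hq _ (h q)))

/-- Maximality makes a block induced, so its vertex set determines it. -/
theorem IsBlock.eq_induce {B : G.Subgraph} (hB : G.IsBlock B) {S : Finset V}
    (hS : (S : Set V) = B.verts) : B = (⊤ : G.Subgraph).induce (S : Set V) := by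
  have hne : S.Nonempty := by
    rw [← Finset.coe_nonempty, hS]; exact hB.1.1.nonempty
  refine hB.eq_of_le ((nonseparable_of_not_isCutVertex hS hB.1.1 hB.1.2).induce hne) ?_
  rw [hS]
  exact Subgraph.le_induce_top_verts

theorem IsBlock.isBlockSet {B : G.Subgraph} (hB : G.IsBlock B) {S : Finset V}
    (hS : (S : Set V) = B.verts) : G.IsBlockSet S := by
  refine ⟨nonseparable_of_not_isCutVertex hS hB.1.1 hB.1.2, fun T hT hST => ?_⟩
  have hne : S.Nonempty := by
    rw [← Finset.coe_nonempty, hS]; exact hB.1.1.nonempty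
  have hle : B ≤ (⊤ : G.Subgraph).induce (T : Set V) := by
    rw [hB.eq_induce hS]
    exact Subgraph.induce_mono_right (by exact_mod_cast hST)
  have h := (hB.2 (hT.induce (hne.mono hST)) hle).1
  intro z hz
  rw [← Finset.mem_coe, hS]
  exact h hz

theorem numBlocks_le_card [Fintype V] (𝓑 : Finset (Finset V)) (h𝓑 : ∀ S, S ∈ 𝓑 ↔ G.IsBlockSet S) :
    G.numBlocks ≤ 𝓑.card := by
  classical
  rw [numBlocks, ← Set.ncard_coe_finset]
  refine Set.ncard_le_ncard_of_injOn (fun B => B.verts.toFinite.toFinset) ?_ ?_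
    (Finset.finite_toSet 𝓑)
  · intro B hB
    exact (h𝓑 _).2 (IsBlock.isBlockSet hB (by simp))
  · intro B hB C hC h
    have h1 := IsBlock.eq_induce hB (S := B.verts.toFinite.toFinset) (by simp)
    have h2 := IsBlock.eq_induce hC (S := C.verts.toFinite.toFinset) (by simp)
    rw [h1, h2]
    simp only at h
    rw [h]

/-! ### The weight count. -/

/-- The weight of a block with at least three vertices, where vertices of a resolving set `W` have
weight two, and those in several such blocks or with trivial representation have weight one. -/
theorem IsBlockSet.three_le_sum [Fintype V] (hG : G.Connected) {W : Finset V}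
    (hW : G.IsConnectivityResolving W) {t : V → ℕ}
    (ht : ∀ S T v, G.IsBlockSet S → G.IsBlockSet T → 3 ≤ S.card → 3 ≤ T.card → v ∈ S → v ∈ T →
      t v < 2 → S = T)
    {U : Finset V} (hU : ∀ v, v ∈ U ↔ v ∉ W ∧ ∀ w ∈ W, G.localConnectivity v w = 1)
    {S : Finset V} (hS : G.IsBlockSet S) (hc : 3 ≤ S.card) :
    3 ≤ ∑ v ∈ S, if v ∈ W then 2 else if 2 ≤ t v then 1 else if v ∈ U then 1 else 0 := by
  set g : V → ℕ := fun v => if v ∈ W then 2 else if 2 ≤ t v then 1 else if v ∈ U then 1 else 0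
  change 3 ≤ ∑ v ∈ S, g v
  have hone : ∀ v ∈ S, t v < 2 → ∀ w ∉ S, G.localConnectivity v w = 1 := by
    intro v hv htv w hw
    refine localConnectivity_eq_one hG (fun h => hw (h ▸ hv)) fun T hT hvT hwT => ?_
    by_contra! hcT
    exact hw (ht S T v hS hT hc hcT hv hvT htv ▸ hwT)
  have hpair : ∀ a ∈ S, ∀ b ∈ S, a ≠ b → 3 ≤ g a + g b → 3 ≤ ∑ v ∈ S, g v := by
    intro a ha b hb hab h
    rw [← Finset.sum_pair hab] at h
    exact h.trans (Finset.sum_le_sum_of_subset (Finset.insert_subset ha (by simpa using hb)))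
  -- If `S` misses `W`, every vertex of `S` has weight 1: it lies in two large blocks or is in `U`.
  rcases (S ∩ W).eq_empty_or_nonempty with he | ⟨w, hw⟩
  · have hnot : ∀ w ∈ W, w ∉ S := fun w hw hwS =>
      Finset.notMem_empty w (he ▸ Finset.mem_inter.2 ⟨hwS, hw⟩)
    refine hc.trans ?_
    rw [Finset.card_eq_sum_ones]
    refine Finset.sum_le_sum fun v hv => ?_
    have hvW : v ∉ W := fun h => hnot v h hv
    by_cases h2 : 2 ≤ t v
    · simp [g, h2, hvW]
    · have : v ∈ U := (hU v).2 ⟨hvW, fun w hw => hone v hv (by omega) w (hnot w hw)⟩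
      simp [g, h2, hvW, this]
  · obtain ⟨hwS, hwW⟩ := Finset.mem_inter.1 hw
    have hgw : g w = 2 := by simp [g, hwW]
    by_cases h2 : ∃ w' ∈ S, w' ∈ W ∧ w' ≠ w
    · obtain ⟨w', hw'S, hw'W, hne⟩ := h2
      have : g w' = 2 := by simp [g, hw'W]
      exact hpair w hwS w' hw'S hne.symm (by omega)
    · push Not at h2
      obtain ⟨x, hx, y, hy, hxw, hyw, hxy, he⟩ := hS.exists_localConnectivity_eq hG hc hwS
      -- As `w` does not separate `x` from `y`, some vertex of `W` outside `S` does, so one of them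
      -- lies in a second large block.
      have hbig : 2 ≤ t x ∨ 2 ≤ t y := by
        by_contra! hlt
        obtain ⟨w', hw', hne⟩ := hW.exists_ne hxy
        by_cases hw'S : w' ∈ S
        · rw [h2 w' hw'S hw'] at hne
          exact hne he
        · exact hne ((hone x hx hlt.1 w' hw'S).trans (hone y hy hlt.2 w' hw'S).symm)
      have hg : ∀ z, 2 ≤ t z → 1 ≤ g z := fun z hz => by
        simp only [g]; split_ifs <;> omega
      rcases hbig with h | h
      · exact hpair w hwS x hx hxw.symm (by have := hg x h; omega)
      · exact hpair w hwS y hy hyw.symm (by have := hg y h; omega)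

theorem card_isBlockSet_lt_two_mul_card [Fintype V] [Nontrivial V] (hG : G.Connected)
    {W : Finset V} (hW : G.IsConnectivityResolving W)
    (𝓑 : Finset (Finset V)) (h𝓑 : ∀ S, S ∈ 𝓑 ↔ G.IsBlockSet S) :
    𝓑.card + 1 ≤ 2 * W.card := by
  classical
  set N := 𝓑.filter (fun S => 3 ≤ S.card) with hN
  set R := 𝓑.filter (fun S => ¬ 3 ≤ S.card) with hR
  have hNR : N.card + R.card = 𝓑.card := Finset.card_filter_add_card_filter_not _
  set t : V → ℕ := fun v => (N.filter (fun S => v ∈ S)).card with htdef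
  set U : Finset V :=
    Finset.univ.filter (fun v => v ∉ W ∧ ∀ w ∈ W, G.localConnectivity v w = 1) with hUdef
  have hU : ∀ v, v ∈ U ↔ v ∉ W ∧ ∀ w ∈ W, G.localConnectivity v w = 1 := by simp [hUdef]
  have hU1 : U.card ≤ 1 := Finset.card_le_one.2 fun x hx y hy => by
    by_contra hxy
    obtain ⟨w, hw, hne⟩ := hW.exists_ne hxy
    exact hne ((((hU x).1 hx).2 w hw).trans (((hU y).1 hy).2 w hw).symm)
  have ht : ∀ S T v, G.IsBlockSet S → G.IsBlockSet T → 3 ≤ S.card → 3 ≤ T.card → v ∈ S → v ∈ T →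
      t v < 2 → S = T := by
    intro S T v hS hT hcS hcT hvS hvT htv
    refine Finset.card_le_one.1 (Nat.lt_succ_iff.1 htv) S ?_ T ?_
    · simp [hN, h𝓑, hS, hcS, hvS]
    · simp [hN, h𝓑, hT, hcT, hvT]
  set g : V → ℕ := fun v => if v ∈ W then 2 else if 2 ≤ t v then 1 else if v ∈ U then 1 else 0
    with hg
  have hcount : ∀ f : V → ℕ, ∑ S ∈ N, ∑ v ∈ S, f v = ∑ v, t v * f v := by
    intro f
    have : ∀ S ∈ N, ∑ v ∈ S, f v = ∑ v, if v ∈ S then f v else 0 := fun S _ => by simp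
    rw [Finset.sum_congr rfl this, Finset.sum_comm]
    refine Finset.sum_congr rfl fun v _ => ?_
    rw [← Finset.sum_filter, Finset.sum_const, smul_eq_mul]
  have h3 : 3 * N.card ≤ ∑ v, t v * g v := by
    rw [← hcount, mul_comm, ← smul_eq_mul, ← Finset.sum_const]
    refine Finset.sum_le_sum fun S hS => ?_
    obtain ⟨hS, hc⟩ := Finset.mem_filter.1 hS
    exact ((h𝓑 S).1 hS).three_le_sum hG hW ht hU hc
  have htree := sum_card_isBlockSet_sub_one_lt hG 𝓑 fun S hS => (h𝓑 S).1 hS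
  have htree' : ∑ v, t v + R.card + 1 ≤ Fintype.card V + N.card := by
    have h1 : ∑ v, t v = ∑ S ∈ N, (S.card - 1) + N.card := by
      have := hcount fun _ => 1
      simp only [mul_one, ← Finset.card_eq_sum_ones] at this
      rw [← this, Finset.card_eq_sum_ones, ← Finset.sum_add_distrib]
      refine Finset.sum_congr rfl fun S hS => ?_
      have := (Finset.mem_filter.1 hS).2
      omega
    have h2 : R.card ≤ ∑ S ∈ R, (S.card - 1) := by
      rw [Finset.card_eq_sum_ones]
      refine Finset.sum_le_sum fun S hS => ?_
      have := ((h𝓑 S).1 (Finset.mem_filter.1 hS).1).two_le_card hG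
      omega
    have h4 := Finset.sum_filter_add_sum_filter_not 𝓑 (fun S => 3 ≤ S.card) (fun S => S.card - 1)
    rw [← hN, ← hR] at h4
    omega
  -- A vertex of `U` in no large block costs 2 rather than 1 in `hpoint`; a two-vertex block at it
  -- pays the excess.
  have hUt : ∀ v ∈ U, t v = 0 → 1 ≤ R.card := by
    intro v _ htv
    obtain ⟨y, hy⟩ := hG.preconnected.exists_adj_of_nontrivial v
    obtain ⟨S, hS, hv, -⟩ := exists_isBlockSet_of_adj hy
    refine Finset.card_pos.2 ⟨S, Finset.mem_filter.2 ⟨(h𝓑 S).2 hS, fun hc => ?_⟩⟩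
    have := Finset.card_eq_zero.1 htv
    exact Finset.notMem_empty S (this ▸ Finset.mem_filter.2
      ⟨Finset.mem_filter.2 ⟨(h𝓑 S).2 hS, hc⟩, hv⟩)
  have hzero : ∀ v, v ∉ W → t v = 0 → v ∈ U := by
    intro v hvW htv
    refine (hU v).2 ⟨hvW, fun w hw => localConnectivity_eq_one hG (fun h => hvW (h ▸ hw)) ?_⟩
    intro S hS hvS _
    by_contra! hc
    have := Finset.card_eq_zero.1 htv
    exact Finset.notMem_empty S (this ▸ Finset.mem_filter.2
      ⟨Finset.mem_filter.2 ⟨(h𝓑 S).2 hS, hc⟩, hvS⟩)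
  have hpoint : ∀ v, 2 + t v * g v ≤ 2 * t v +
      ((if v ∈ W then 2 else 0) + if v ∈ U then (if t v = 0 then 2 else 1) else 0) := by
    intro v
    by_cases hvW : v ∈ W
    · simp only [hg, hvW, if_true]; omega
    · by_cases h0 : t v = 0
      · simp [h0, hzero v hvW h0]
      · by_cases h2 : 2 ≤ t v
        · simp only [hg, hvW, h2, if_true, if_false]; omega
        · have h1 : t v = 1 := by omega
          by_cases hvU : v ∈ U <;> simp [hg, hvW, h1, hvU]
  have hsum := Finset.sum_le_sum fun v (_ : v ∈ Finset.univ) => hpoint v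
  simp only [Finset.sum_add_distrib, ← Finset.mul_sum, Finset.sum_const, Finset.card_univ,
    smul_eq_mul] at hsum
  have hWsum : ∑ v, (if v ∈ W then 2 else 0) = 2 * W.card := by
    simp [mul_comm]
  have hUsum : ∑ v, (if v ∈ U then (if t v = 0 then 2 else 1) else 0) ≤ 1 + R.card := by
    rw [← Finset.sum_filter, Finset.filter_mem_eq_inter, Finset.univ_inter]
    rcases Finset.eq_empty_or_nonempty U with he | ⟨u, hu⟩
    · simp [he]
    · have : U = {u} := Finset.eq_singleton_iff_unique_mem.2
        ⟨hu, fun x hx => Finset.card_le_one.1 hU1 x hx u hu⟩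
      rw [this, Finset.sum_singleton]
      split_ifs with h
      · have := hUt u hu h; omega
      · omega
  rw [hWsum] at hsum
  -- Sum of `hpoint`, with `h3` on the left and twice `htree'` on the right.
  omega

end SimpleGraph

theorem mainTheorem2 {V : Type*} [Finite V] (G : SimpleGraph V) (hG : G.Connected)
    (hV : 2 ≤ Nat.card V) :
    (G.cdim : ℝ) ≥ ((G.numBlocks : ℝ) + 1) / 2 := by
  classical
  have := Fintype.ofFinite V
  have : Nontrivial V := Finite.one_lt_card_iff_nontrivial.1 hV
  obtain ⟨W, hW, hcard⟩ := G.exists_isConnectivityResolving_card_eq_cdim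
  have h𝓑 : ∀ S, S ∈ Finset.univ.filter G.IsBlockSet ↔ G.IsBlockSet S := by simp
  have h1 := SimpleGraph.numBlocks_le_card _ h𝓑
  have h2 := SimpleGraph.card_isBlockSet_lt_two_mul_card hG hW _ h𝓑
  have h3 : (G.numBlocks : ℝ) + 1 ≤ 2 * G.cdim := by
    rw [← hcard]; exact_mod_cast (by omega : G.numBlocks + 1 ≤ 2 * W.card)
  linarith
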